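/- All graphs are finite, simple and undirected. A \(k\)-colouring of a graph \(G\) is a map \(f\colon V(G)\to\{0,1,\dots,k-1\}\) with \(f(u)\neq f(v)\) for every edge \(uv\) of \(G\). A bicoloured component of \((G,f)\) is a connected component of the subgraph of \(G\) induced by the union of two distinct colour classes \(f^{-1}(i)\cup f^{-1}(j)\), \(i\neq j\). The colouring \(f\) is a \(k\)-star colouring if every bicoloured component is a star \(K_{1,q}\) with \(q\geq 0\), and it is a distance-two \(k\)-colouring if every bicoloured component is \(K_1\) or \(K_2\). A graph is \(k\)-star colourable (respectively, distance-two \(k\)-colourable) if it admits a \(k\)-star colouring (respectively, a distance-two \(k\)-colouring). The line graph \(L(G)\) has vertex set \(E(G)\), and two distinct edges of \(G\) are adjacent in \(L(G)\) if they share an endpoint. **Theorem.** For every 3-regular graph \(G\), the line graph \(L(G)\) is 4-star colourable if and only if \(G\) is bipartite and distance-two 4-colourable. -/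

import Mathlib

/-- The subgraph of `G` induced by the colour classes of `i` and `j` under the colouring `f`. -/
def bicolouredSubgraph {V : Type*} {G : SimpleGraph V} {k : ℕ} (f : G.Coloring (Fin k))
    (i j : Fin k) : SimpleGraph {v : V | f v = i ∨ f v = j} :=
  G.induce {v : V | f v = i ∨ f v = j}

/-- A `k`-colouring is a `k`-star colouring if every bicoloured component is a star `K_{1,q}`,
where `q ≥ 0`. -/
def IsStarColouring {V : Type*} {G : SimpleGraph V} {k : ℕ} (f : G.Coloring (Fin k)) : Prop :=
  ∀ i j : Fin k, i ≠ j → ∀ C : (bicolouredSubgraph f i j).ConnectedComponent,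
    ∃ q : ℕ, Nonempty (C.toSimpleGraph ≃g completeBipartiteGraph (Fin 1) (Fin q))

/-- A `k`-colouring is a distance-two `k`-colouring if every bicoloured component is
`K_1` or `K_2`. -/
def IsDistanceTwoColouring {V : Type*} {G : SimpleGraph V} {k : ℕ}
    (f : G.Coloring (Fin k)) : Prop :=
  ∀ i j : Fin k, i ≠ j → ∀ C : (bicolouredSubgraph f i j).ConnectedComponent,
    Nonempty (C.toSimpleGraph ≃g (⊤ : SimpleGraph (Fin 1))) ∨
      Nonempty (C.toSimpleGraph ≃g (⊤ : SimpleGraph (Fin 2)))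

/-- `G` is `k`-star colourable. -/
def StarColourable {V : Type*} (G : SimpleGraph V) (k : ℕ) : Prop :=
  ∃ f : G.Coloring (Fin k), IsStarColouring f

/-- `G` is distance-two `k`-colourable. -/
def DistanceTwoColourable {V : Type*} (G : SimpleGraph V) (k : ℕ) : Prop :=
  ∃ f : G.Coloring (Fin k), IsDistanceTwoColouring f

/-! A 4-star colouring of `L(G)` is a proper 4-edge-colouring of the cubic graph `G` in which no
four consecutive edges, forming a path or a 4-cycle, alternate two colours. Each vertex `v` misses
one colour `c v`, and missing alternating paths force `c` to be a distance-two colouring. An edge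
`uv` avoids `c u` and `c v`, so two colours remain; the Latin square `L` names them `L (c u) (c v)`
and `L (c v) (c u)`, which orients the edge. All edges at a vertex turn out to be oriented alike, so
sources and sinks bipartition `G`. Conversely, a bipartition supplies the orientation, and `L` turns
`c` back into an edge colouring. -/

/-! ### Recognising stars, `K_1` and `K_2`. -/

theorem SimpleGraph.Connected.forall_mem_of_adj_closed {W : Type*} {H : SimpleGraph W}
    (hH : H.Connected) {S : Set W} {v : W} (hv : v ∈ S)
    (hS : ∀ x y, x ∈ S → H.Adj x y → y ∈ S) (w : W) : w ∈ S := by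
  obtain ⟨p⟩ := hH.preconnected v w
  induction p with
  | nil => exact hv
  | cons h _ ih => exact ih (hS _ _ hv h)

/-- A connected triangle-free graph without a path or cycle on four vertices has a vertex
adjacent to all others, and is otherwise edgeless. -/
theorem SimpleGraph.Connected.exists_star_centre {W : Type*} {H : SimpleGraph W}
    (hH : H.Connected) (htri : ∀ x y z, H.Adj x y → H.Adj y z → ¬ H.Adj x z)
    (hP : ∀ a b c d, H.Adj a b → H.Adj b c → H.Adj c d → a ≠ c → b = d) :
    ∃ v, ∀ x y, H.Adj x y ↔ (x = v ∧ y ≠ v) ∨ (x ≠ v ∧ y = v) := by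
  obtain ⟨v, hv⟩ : ∃ v, ∀ w, w = v ∨ H.Adj v w := by
    -- The centre must be a vertex with two neighbours; if there is none, any vertex will do.
    by_cases h : ∃ a v b, H.Adj a v ∧ H.Adj v b ∧ a ≠ b
    · obtain ⟨a, v, b, hav, hvb, hab⟩ := h
      refine ⟨v, hH.forall_mem_of_adj_closed (S := {w | w = v ∨ H.Adj v w}) (Or.inl rfl) ?_⟩
      rintro x y (rfl | hx) hxy
      · exact Or.inr hxy
      · by_cases hax : a = x
        · exact Or.inl (hP b v x y hvb.symm hx hxy (fun h => hab (hax.trans h.symm))).symm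
        · exact Or.inl (hP a v x y hav hx hxy hax).symm
    · push Not at h
      obtain ⟨v⟩ := hH.nonempty
      refine ⟨v, hH.forall_mem_of_adj_closed (S := {w | w = v ∨ H.Adj v w}) (Or.inl rfl) ?_⟩
      rintro x y (rfl | hx) hxy
      · exact Or.inr hxy
      · exact Or.inl (h v x y hx hxy).symm
  refine ⟨v, fun x y => ⟨fun hxy => ?_, ?_⟩⟩
  · rcases hv x with rfl | hx
    · exact Or.inl ⟨rfl, hxy.ne'⟩
    · rcases hv y with rfl | hy
      · exact Or.inr ⟨hx.ne', rfl⟩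
      · exact absurd hy (htri v x y hx hxy)
  · rintro (⟨rfl, h⟩ | ⟨h, rfl⟩)
    · exact (hv y).resolve_left h
    · exact ((hv x).resolve_left h).symm

theorem SimpleGraph.Connected.nonempty_iso_star {W : Type*} [Finite W] {H : SimpleGraph W}
    (hH : H.Connected) (htri : ∀ x y z, H.Adj x y → H.Adj y z → ¬ H.Adj x z)
    (hP : ∀ a b c d, H.Adj a b → H.Adj b c → H.Adj c d → a ≠ c → b = d) :
    ∃ q : ℕ, Nonempty (H ≃g completeBipartiteGraph (Fin 1) (Fin q)) := by
  classical
  obtain ⟨v, hv⟩ := hH.exists_star_centre htri hP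
  obtain ⟨q, ⟨e⟩⟩ := Finite.exists_equiv_fin {w : W // ¬ w = v}
  let φ : W ≃ Fin 1 ⊕ Fin q :=
    (Equiv.sumCompl (fun w => w = v)).symm.trans
      (Equiv.sumCongr (Equiv.ofUnique {w : W // w = v} (Fin 1)) e)
  have hl : ∀ w, (φ w).isLeft = true ↔ w = v := by
    intro w
    by_cases h : w = v
    · simp [φ, h]
    · simp [φ, Equiv.sumCompl_symm_apply_of_neg (p := fun w => w = v) h, h]
  have hr : ∀ w, (φ w).isRight = true ↔ ¬ w = v := by
    intro w
    rw [← hl w]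
    cases φ w <;> simp
  refine ⟨q, ⟨⟨φ, ?_⟩⟩⟩
  intro x y
  rw [completeBipartiteGraph_adj, hl, hr, hl, hr, hv]

theorem SimpleGraph.Connected.nonempty_iso_top {W : Type*} [Finite W] {H : SimpleGraph W}
    (hH : H.Connected) (hP : ∀ a b c, H.Adj a b → H.Adj b c → a = c) :
    Nonempty (H ≃g (⊤ : SimpleGraph (Fin 1))) ∨ Nonempty (H ≃g (⊤ : SimpleGraph (Fin 2))) := by
  have hall : ∀ v w, w = v ∨ H.Adj v w := by
    intro v
    refine hH.forall_mem_of_adj_closed (S := {w | w = v ∨ H.Adj v w}) (Or.inl rfl) ?_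
    rintro x y (rfl | hx) hxy
    · exact Or.inr hxy
    · exact Or.inl (hP v x y hx hxy).symm
  obtain ⟨n, ⟨e⟩⟩ := Finite.exists_equiv_fin W
  let φ : H ≃g (⊤ : SimpleGraph (Fin n)) := ⟨e, by
    intro x y
    rw [SimpleGraph.top_adj, e.injective.ne_iff]
    exact ⟨fun h => (hall x y).resolve_left h.symm, fun h => h.ne⟩⟩
  have hn : n ≤ 2 := by
    by_contra! hn
    have h (a b : Fin n) (hab : a ≠ b) : H.Adj (e.symm a) (e.symm b) :=
      (hall _ _).resolve_left (e.symm.injective.ne hab.symm)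
    have h1 := hP _ _ _ (h ⟨0, by omega⟩ ⟨1, by omega⟩ (by simp))
      (h ⟨1, by omega⟩ ⟨2, by omega⟩ (by simp))
    simpa using e.symm.injective h1
  obtain ⟨v⟩ := hH.nonempty
  have hpos : n ≠ 0 := by
    rintro rfl
    exact (e v).elim0
  obtain rfl | rfl : n = 1 ∨ n = 2 := by omega
  · exact Or.inl ⟨φ⟩
  · exact Or.inr ⟨φ⟩

/-! ### Local forms of the two colouring conditions. -/

/-- A colouring is a star colouring iff it has no bicoloured path or cycle on four vertices. -/
theorem isStarColouring_iff {V : Type*} [Finite V] {G : SimpleGraph V} {k : ℕ}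
    (f : G.Coloring (Fin k)) :
    IsStarColouring f ↔ ∀ a b c d, G.Adj a b → G.Adj b c → G.Adj c d → a ≠ c → b ≠ d →
      f a = f c → f b = f d → False := by
  constructor
  · intro hf a b c d hab hbc hcd hac hbd h1 h2
    let T := bicolouredSubgraph f (f a) (f b)
    let a' : {v : V | f v = f a ∨ f v = f b} := ⟨a, Or.inl rfl⟩
    let b' : {v : V | f v = f a ∨ f v = f b} := ⟨b, Or.inr rfl⟩
    let c' : {v : V | f v = f a ∨ f v = f b} := ⟨c, Or.inl h1.symm⟩
    let d' : {v : V | f v = f a ∨ f v = f b} := ⟨d, Or.inr h2.symm⟩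
    have hab' : T.Adj a' b' := hab
    have hbc' : T.Adj b' c' := hbc
    have hcd' : T.Adj c' d' := hcd
    let C := T.connectedComponentMk a'
    have hb : b' ∈ C.supp := SimpleGraph.ConnectedComponent.sound hab'.reachable.symm
    have hc : c' ∈ C.supp := SimpleGraph.ConnectedComponent.sound
      (hab'.reachable.trans hbc'.reachable).symm
    have hd : d' ∈ C.supp := SimpleGraph.ConnectedComponent.sound
      ((hab'.reachable.trans hbc'.reachable).trans hcd'.reachable).symm
    obtain ⟨q, ⟨φ⟩⟩ := hf (f a) (f b) (f.valid hab) C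
    have e1 : C.toSimpleGraph.Adj ⟨a', rfl⟩ ⟨b', hb⟩ := hab'
    have e2 : C.toSimpleGraph.Adj ⟨b', hb⟩ ⟨c', hc⟩ := hbc'
    have e3 : C.toSimpleGraph.Adj ⟨c', hc⟩ ⟨d', hd⟩ := hcd'
    have n1 := φ.injective.ne (a₁ := ⟨a', rfl⟩) (a₂ := ⟨c', hc⟩)
      (fun h => hac (congrArg (fun z => z.1.1) h))
    have n2 := φ.injective.ne (a₁ := ⟨b', hb⟩) (a₂ := ⟨d', hd⟩)
      (fun h => hbd (congrArg (fun z => z.1.1) h))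
    rw [← φ.map_adj_iff, completeBipartiteGraph_adj] at e1 e2 e3
    revert e1 e2 e3 n1 n2
    generalize φ ⟨a', rfl⟩ = A
    generalize φ ⟨b', hb⟩ = B
    generalize φ ⟨c', hc⟩ = C
    generalize φ ⟨d', hd⟩ = D
    -- A walk on four vertices alternates sides, so two of them two steps apart lie on the one-point
    -- side and coincide.
    rcases A with A | A <;> rcases B with B | B <;> rcases C with C | C <;>
      rcases D with D | D <;> simp [eq_iff_true_of_subsingleton]
  · intro h i j hij C
    have key : ∀ x y, C.toSimpleGraph.Adj x y → f x.1.1 ≠ f y.1.1 := fun x y hxy => f.valid hxy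
    have hcol : ∀ x : C, f x.1.1 = i ∨ f x.1.1 = j := fun x => x.1.2
    have key2 : ∀ x y z, C.toSimpleGraph.Adj x y → C.toSimpleGraph.Adj y z →
        f x.1.1 = f z.1.1 := by
      intro x y z hxy hyz
      have := key _ _ hxy
      have := key _ _ hyz
      have := hcol x
      have := hcol y
      have := hcol z
      grind
    refine C.connected_toSimpleGraph.nonempty_iso_star ?_ ?_
    · intro x y z hxy hyz hxz
      exact key _ _ hxz (key2 _ _ _ hxy hyz)
    · intro a b c d hab hbc hcd hac
      by_contra hbd
      exact h a.1.1 b.1.1 c.1.1 d.1.1 hab hbc hcd (fun h => hac (Subtype.ext (Subtype.ext h)))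
        (fun h => hbd (Subtype.ext (Subtype.ext h))) (key2 _ _ _ hab hbc) (key2 _ _ _ hbc hcd)

/-- A colouring is a distance-two colouring iff distinct vertices with a common neighbour
receive distinct colours. -/
theorem isDistanceTwoColouring_iff {V : Type*} [Finite V] {G : SimpleGraph V} {k : ℕ}
    (f : G.Coloring (Fin k)) :
    IsDistanceTwoColouring f ↔ ∀ a b c, G.Adj a b → G.Adj b c → a ≠ c → f a ≠ f c := by
  constructor
  · intro hf a b c hab hbc hac h1
    let T := bicolouredSubgraph f (f a) (f b)
    let a' : {v : V | f v = f a ∨ f v = f b} := ⟨a, Or.inl rfl⟩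
    let b' : {v : V | f v = f a ∨ f v = f b} := ⟨b, Or.inr rfl⟩
    let c' : {v : V | f v = f a ∨ f v = f b} := ⟨c, Or.inl h1.symm⟩
    have hab' : T.Adj a' b' := hab
    have hbc' : T.Adj b' c' := hbc
    let C := T.connectedComponentMk a'
    have hb : b' ∈ C.supp := SimpleGraph.ConnectedComponent.sound hab'.reachable.symm
    have hc : c' ∈ C.supp := SimpleGraph.ConnectedComponent.sound
      (hab'.reachable.trans hbc'.reachable).symm
    have n1 : (⟨a', rfl⟩ : C.supp) ≠ ⟨b', hb⟩ := fun h => hab.ne (congrArg (fun z => z.1.1) h)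
    have n2 : (⟨b', hb⟩ : C.supp) ≠ ⟨c', hc⟩ := fun h => hbc.ne (congrArg (fun z => z.1.1) h)
    have n3 : (⟨a', rfl⟩ : C.supp) ≠ ⟨c', hc⟩ := fun h => hac (congrArg (fun z => z.1.1) h)
    rcases hf (f a) (f b) (f.valid hab) C with ⟨⟨φ⟩⟩ | ⟨⟨φ⟩⟩
    · exact φ.injective.ne n1 (Subsingleton.elim _ _)
    · have m1 := φ.injective.ne n1
      have m2 := φ.injective.ne n2
      have m3 := φ.injective.ne n3
      omega
  · intro h i j hij C
    refine C.connected_toSimpleGraph.nonempty_iso_top ?_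
    intro a b c hab hbc
    by_contra hac
    have h0 : f a.1.1 ≠ f c.1.1 := h a.1.1 b.1.1 c.1.1 hab hbc
      (fun h => hac (Subtype.ext (Subtype.ext h)))
    have h1 : f a.1.1 ≠ f b.1.1 := f.valid hab
    have h2 : f b.1.1 ≠ f c.1.1 := f.valid hbc
    have ha : f a.1.1 = i ∨ f a.1.1 = j := a.1.2
    have hb : f b.1.1 = i ∨ f b.1.1 = j := b.1.2
    have hc : f c.1.1 = i ∨ f c.1.1 = j := c.1.2
    grind

/-! ### The Latin square of order four. -/

/-- The idempotent Latin square of order four. -/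
def idempotentLatinSquare : Fin 4 → Fin 4 → Fin 4 :=
  ![![0, 3, 1, 2], ![2, 1, 3, 0], ![3, 0, 2, 1], ![1, 2, 0, 3]]

theorem idempotentLatinSquare_injective_right : ∀ i j j' : Fin 4,
    idempotentLatinSquare i j = idempotentLatinSquare i j' → j = j' := by decide

theorem idempotentLatinSquare_injective_left : ∀ i i' j : Fin 4,
    idempotentLatinSquare i j = idempotentLatinSquare i' j → i = i' := by decide

theorem idempotentLatinSquare_ne : ∀ i j : Fin 4, i ≠ j →
    idempotentLatinSquare i j ≠ i ∧ idempotentLatinSquare i j ≠ j := by decide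

theorem idempotentLatinSquare_eq_or_eq : ∀ i j k : Fin 4, i ≠ j → k ≠ i → k ≠ j →
    k = idempotentLatinSquare i j ∨ k = idempotentLatinSquare j i := by decide

theorem idempotentLatinSquare_swap_ne : ∀ i j : Fin 4, i ≠ j →
    idempotentLatinSquare i j ≠ idempotentLatinSquare j i := by decide

/-- Row `i` permutes the other three colours cyclically, so outside the excluded swap the conditions
on `k` leave only one value. -/
theorem idempotentLatinSquare_propagate : ∀ i j l k : Fin 4, i ≠ j → i ≠ l → j ≠ l →
    k ≠ i → k ≠ l → k ≠ idempotentLatinSquare i j →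
    ¬ (idempotentLatinSquare i j = l ∧ k = j) → k = idempotentLatinSquare i l := by decide

/-! ### Sufficiency: colouring the edges from a bipartition and a distance-two colouring. -/

theorem lineGraph_starColourable_of_bipartite {V : Type*} [Finite V] {G : SimpleGraph V}
    (s : G.Coloring (Fin 2)) (c : G.Coloring (Fin 4))
    (hc : ∀ a b d, G.Adj a b → G.Adj b d → a ≠ d → c a ≠ c d) :
    StarColourable G.lineGraph 4 := by
  have hex : ∀ e : G.edgeSet, ∃ u v, e.1 = s(u, v) ∧ s u = 0 ∧ s v = 1 := by
    rintro ⟨e, he⟩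
    induction e using Sym2.ind with
    | _ u v =>
      have hne : s u ≠ s v := s.valid he
      by_cases hu : s u = 0
      · exact ⟨u, v, rfl, hu, by omega⟩
      · exact ⟨v, u, Sym2.eq_swap, by omega, by omega⟩
  choose A B hAB hA hB using hex
  have hadj : ∀ e, G.Adj (A e) (B e) := fun e => by
    have := e.2
    rwa [hAB e] at this
  let f : G.edgeSet → Fin 4 := fun e => idempotentLatinSquare (c (A e)) (c (B e))
  have hmem : ∀ e : G.edgeSet, ∀ v, v ∈ e.1 → v = A e ∨ v = B e := by
    intro e v hv
    rw [hAB e] at hv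
    exact Sym2.mem_iff.1 hv
  have hmiss : ∀ e : G.edgeSet, ∀ v, v ∈ e.1 → f e ≠ c v := by
    intro e v hv
    have := idempotentLatinSquare_ne _ _ (c.valid (hadj e))
    rcases hmem e v hv with rfl | rfl
    · exact this.1
    · exact this.2
  have hprop : ∀ e e' : G.edgeSet, ∀ v, v ∈ e.1 → v ∈ e'.1 → e ≠ e' → f e ≠ f e' := by
    intro e e' v hv hv' hne hf
    rcases hmem e v hv with h | h <;> rcases hmem e' v hv' with h' | h'
    · have hA' : A e = A e' := h.symm.trans h'
      refine hc (B e) (A e) (B e') (hadj e).symm (hA' ▸ hadj e') ?_ ?_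
      · intro hB'
        exact hne (Subtype.ext (by rw [hAB e, hAB e', hA', hB']))
      · refine idempotentLatinSquare_injective_right (c (A e)) _ _ (hf.trans ?_)
        rw [hA']
    · have := hA e
      have := hB e'
      rw [← h] at *
      rw [← h'] at *
      omega
    · have := hB e
      have := hA e'
      rw [← h] at *
      rw [← h'] at *
      omega
    · have hB' : B e = B e' := h.symm.trans h'
      refine hc (A e) (B e) (A e') (hadj e) (hB' ▸ (hadj e').symm) ?_ ?_
      · intro hA'
        exact hne (Subtype.ext (by rw [hAB e, hAB e', hA', hB']))
      · refine idempotentLatinSquare_injective_left _ _ (c (B e)) (hf.trans ?_)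
        rw [hB']
  have hF : ∀ {e e'}, G.lineGraph.Adj e e' → f e ≠ f e' := by
    rintro e e' ⟨hne, v, hv, hv'⟩
    exact hprop e e' v hv hv' hne
  refine ⟨SimpleGraph.Coloring.mk f hF, (isStarColouring_iff _).2 ?_⟩
  rintro e₁ e₂ e₃ e₄ h12 h23 h34 h13 h24 (hf13 : f e₁ = f e₃) (hf24 : f e₂ = f e₄)
  have hf12 := hF h12
  obtain ⟨hn12, v₁, h11, h12⟩ := h12
  obtain ⟨hn23, v₂, h22, h23⟩ := h23
  obtain ⟨hn34, v₃, h33, h34⟩ := h34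
  have n12 : v₁ ≠ v₂ := by
    rintro rfl
    exact hprop e₁ e₃ v₁ h11 h23 h13 hf13
  have n23 : v₂ ≠ v₃ := by
    rintro rfl
    exact hprop e₂ e₄ v₂ h22 h34 h24 hf24
  have E2 : e₂.1 = s(v₁, v₂) := (Sym2.mem_and_mem_iff n12).1 ⟨h12, h22⟩
  have E3 : e₃.1 = s(v₂, v₃) := (Sym2.mem_and_mem_iff n23).1 ⟨h23, h33⟩
  have a12 : G.Adj v₁ v₂ := by
    have := e₂.2
    rwa [E2] at this
  have a23 : G.Adj v₂ v₃ := by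
    have := e₃.2
    rwa [E3] at this
  have n13 : v₁ ≠ v₃ := by
    rintro rfl
    exact hn23 (Subtype.ext (by rw [E2, E3, Sym2.eq_swap]))
  have c13 := hc _ _ _ a12 a23 n13
  have c12 : c v₁ ≠ c v₂ := c.valid a12
  have c23 : c v₂ ≠ c v₃ := c.valid a23
  -- The two alternating colours both avoid the three distinct colours of `v₁`, `v₂`, `v₃`, but only
  -- one colour is left.
  have := hmiss e₁ v₁ h11
  have := hmiss e₂ v₁ h12
  have := hmiss e₂ v₂ h22
  have := hmiss e₃ v₂ h23
  have := hmiss e₃ v₃ h33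
  have := hmiss e₄ v₃ h34
  omega

/-! ### Necessity: the missing colour at each vertex. -/

/-- A symmetric proper 4-edge-colouring of a cubic graph leaves exactly one colour missing at
each vertex. -/
theorem exists_missing_colour {V : Type*} {G : SimpleGraph V} [G.LocallyFinite]
    (hG : G.IsRegularOfDegree 3) (col : V → V → Fin 4)
    (hp : ∀ v u w, G.Adj v u → G.Adj v w → col v u = col v w → u = w) (v : V) :
    ∃ m, (∀ w, G.Adj v w → col v w ≠ m) ∧ ∀ k, k ≠ m → ∃ w, G.Adj v w ∧ col v w = k := by
  classical
  have h3 : ((G.neighborFinset v).image (col v)).card = 3 := by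
    rw [Finset.card_image_of_injOn, G.card_neighborFinset_eq_degree, hG v]
    intro u hu w hw h
    exact hp v u w (by simpa using hu) (by simpa using hw) h
  have h1 : ((G.neighborFinset v).image (col v))ᶜ.card = 1 := by
    rw [Finset.card_compl, h3, Fintype.card_fin]
  obtain ⟨m, hm⟩ := Finset.card_eq_one.1 h1
  have key : ∀ k, k = m ↔ ¬ ∃ w, G.Adj v w ∧ col v w = k := by
    intro k
    rw [← Finset.mem_singleton, ← hm]
    simp
  refine ⟨m, fun w hw h => (key m).1 rfl ⟨w, hw, h⟩, fun k hk => ?_⟩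
  by_contra h
  exact hk ((key k).2 h)

section MissingColour

variable {V : Type*} {G : SimpleGraph V} {col : V → V → Fin 4} {c : V → Fin 4}

/-- If `c u = c v`, let `b`, `b'` be the other two colours at `u`, leading to `x`, `x'`. Both `x`
and `x'` must miss `col u v`, or a path through `uv` alternates; then they see `b'` and `b`, and a
path through `x u x'` alternates. -/
theorem missing_colour_ne_of_adj (hsymm : ∀ u v, col u v = col v u)
    (hc : ∀ v w, G.Adj v w → col v w ≠ c v)
    (hn : ∀ v k, k ≠ c v → ∃ w, G.Adj v w ∧ col v w = k)
    (hstar : ∀ z x u v y, G.Adj z x → G.Adj x u → G.Adj u v → G.Adj v y →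
      col z x = col u v → col x u = col v y → col x u ≠ col u v → False)
    {u v : V} (huv : G.Adj u v) : c u ≠ c v := by
  intro hcuv
  have ha : col u v ≠ c u := hc u v huv
  obtain ⟨b, b', hb, hb', hba, hba', hbb⟩ : ∃ b b' : Fin 4, b ≠ c u ∧ b' ≠ c u ∧
      b ≠ col u v ∧ b' ≠ col u v ∧ b ≠ b' := by
    clear hcuv
    generalize col u v = a at *
    generalize c u = d at *
    revert a d
    decide
  have step : ∀ b x, b ≠ c u → b ≠ col u v → G.Adj u x → col u x = b → c x = col u v := by
    intro b x hb hba hux hxb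
    by_contra hne
    obtain ⟨z, hxz, hz⟩ := hn x (col u v) (Ne.symm hne)
    obtain ⟨y, hvy, hy⟩ := hn v b (hcuv ▸ hb)
    refine hstar z x u v y hxz.symm hux.symm huv hvy ?_ ?_ ?_
    · rw [hsymm, hz]
    · rw [hsymm, hxb, hy]
    · rwa [hsymm, hxb]
  obtain ⟨x, hux, hx⟩ := hn u b hb
  obtain ⟨x', hux', hx'⟩ := hn u b' hb'
  obtain ⟨z, hxz, hz⟩ := hn x b' (by rw [step b x hb hba hux hx]; exact hba')
  obtain ⟨z', hxz', hz'⟩ := hn x' b (by rw [step b' x' hb' hba' hux' hx']; exact hba)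
  refine hstar z x u x' z' hxz.symm hux.symm hux' hxz' ?_ ?_ ?_
  · rw [hsymm, hz, hx']
  · rw [hsymm, hx, hz']
  · rwa [hsymm, hx, hx']

/-- If the missing colours agreed, the path `u v w` would extend at both ends to an alternating one.
-/
theorem missing_colour_ne_of_common_neighbour (hsymm : ∀ u v, col u v = col v u)
    (hp : ∀ v u w, G.Adj v u → G.Adj v w → col v u = col v w → u = w)
    (hc : ∀ v w, G.Adj v w → col v w ≠ c v)
    (hn : ∀ v k, k ≠ c v → ∃ w, G.Adj v w ∧ col v w = k)
    (hstar : ∀ z x u v y, G.Adj z x → G.Adj x u → G.Adj u v → G.Adj v y →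
      col z x = col u v → col x u = col v y → col x u ≠ col u v → False)
    {u v w : V} (huv : G.Adj u v) (hvw : G.Adj v w) (huw : u ≠ w) : c u ≠ c w := by
  intro h
  have h1 : col v w ≠ c u := by
    rw [h, hsymm]
    exact hc w v hvw.symm
  have h2 : col u v ≠ c w := by
    rw [← h]
    exact hc u v huv
  obtain ⟨z, huz, hz⟩ := hn u (col v w) h1
  obtain ⟨y, hwy, hy⟩ := hn w (col u v) h2
  refine hstar z u v w y huz.symm huv hvw hwy ?_ hy.symm ?_
  · rw [hsymm, hz]
  · intro h'
    exact huw (hp v u w huv.symm hvw (by rw [hsymm, h']))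

theorem colour_eq_latinSquare_of_common_endpoint
    (hp : ∀ v u w, G.Adj v u → G.Adj v w → col v u = col v w → u = w)
    (hc : ∀ v w, G.Adj v w → col v w ≠ c v ∧ col v w ≠ c w)
    (hn : ∀ v k, k ≠ c v → ∃ w, G.Adj v w ∧ col v w = k)
    (hadj : ∀ u v, G.Adj u v → c u ≠ c v)
    (hdist : ∀ u v w, G.Adj u v → G.Adj v w → u ≠ w → c u ≠ c w)
    {u v w : V} (huv : G.Adj u v) (huw : G.Adj u w)
    (h : col u v = idempotentLatinSquare (c u) (c v)) :
    col u w = idempotentLatinSquare (c u) (c w) := by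
  by_cases hvw : v = w
  · rwa [← hvw]
  refine idempotentLatinSquare_propagate _ (c v) _ _ (hadj u v huv) (hadj u w huw)
    (hdist v u w huv.symm huw hvw) (hc u w huw).1 (hc u w huw).2 ?_ ?_
  · rw [← h]
    exact fun h' => hvw (hp u v w huv huw h'.symm)
  · rw [← h]
    -- In the swapped case the third edge at `u` has the fourth colour `m`, yet its far end, at
    -- distance at most two from `u`, `v`, `w`, must miss `m` as well.
    rintro ⟨h1, h2⟩
    obtain ⟨m, hmu, hmv, hmw⟩ : ∃ m : Fin 4, m ≠ c u ∧ m ≠ c v ∧ m ≠ c w := by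
      generalize c u = a
      generalize c v = b
      generalize c w = d
      revert a b d
      decide
    obtain ⟨x, hux, hx⟩ := hn u m hmu
    have hxv : x ≠ v := by
      rintro rfl
      exact hmw (hx.symm.trans h1)
    have hxw : x ≠ w := by
      rintro rfl
      exact hmv (hx.symm.trans h2)
    have := hdist x u v hux.symm huv hxv
    have := hdist x u w hux.symm huw hxw
    have := hdist v u w huv.symm huw hvw
    have := hadj u x hux
    have := hadj u v huv
    have := hadj u w huw
    have := (hc u x hux).2
    omega

end MissingColour

theorem mainTheorem3 {V : Type*} [Fintype V] (G : SimpleGraph V) [G.LocallyFinite]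
    (hG : G.IsRegularOfDegree 3) :
    StarColourable G.lineGraph 4 ↔ G.IsBipartite ∧ DistanceTwoColourable G 4 := by
  classical
  constructor
  · rintro ⟨f, hf⟩
    rw [isStarColouring_iff] at hf
    -- The value on non-edges is arbitrary, but must be symmetric.
    let col : V → V → Fin 4 := fun u v => if h : G.Adj u v then f ⟨s(u, v), h⟩ else 0
    have hcol : ∀ u v (h : G.Adj u v), col u v = f ⟨s(u, v), h⟩ := fun u v h => dif_pos h
    have hsymm : ∀ u v, col u v = col v u := by
      intro u v
      by_cases h : G.Adj u v
      · rw [hcol u v h, hcol v u h.symm]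
        congr 2
        exact Sym2.eq_swap
      · have h' : ¬ G.Adj v u := fun h' => h h'.symm
        simp [col, h, h']
    have hline : ∀ v u w (h : G.Adj u v) (h' : G.Adj v w), u ≠ w →
        G.lineGraph.Adj ⟨s(u, v), h⟩ ⟨s(v, w), h'⟩ := by
      intro v u w h h' hne
      refine ⟨fun e => ?_, v, by simp, by simp⟩
      have := congrArg Subtype.val e
      simp only [Sym2.eq_iff] at this
      rcases this with ⟨h1, -⟩ | ⟨h1, -⟩
      · exact h.ne h1
      · exact hne h1
    have hp : ∀ v u w, G.Adj v u → G.Adj v w → col v u = col v w → u = w := by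
      intro v u w hu hw h
      by_contra hne
      rw [hsymm v u, hcol u v hu.symm, hcol v w hw] at h
      exact f.valid (hline v u w hu.symm hw hne) h
    have hstar : ∀ z x u v y, G.Adj z x → G.Adj x u → G.Adj u v → G.Adj v y →
        col z x = col u v → col x u = col v y → col x u ≠ col u v → False := by
      intro z x u v y hzx hxu huv hvy h1 h2 h3
      have hzu : z ≠ u := by
        rintro rfl
        exact h3 (by rw [hsymm, h1])
      have hxv : x ≠ v := by
        rintro rfl
        exact h3 (hsymm _ _)
      have huy : u ≠ y := by
        rintro rfl
        exact h3 (by rw [h2, hsymm])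
      rw [hcol z x hzx, hcol u v huv] at h1
      rw [hcol x u hxu, hcol v y hvy] at h2
      rw [hcol x u hxu, hcol u v huv] at h3
      refine hf _ _ _ _ (hline x z u hzx hxu hzu) (hline u x v hxu huv hxv)
        (hline v u y huv hvy huy) (fun e => ?_) (fun e => ?_) h1 h2
      · have := congrArg Subtype.val e
        simp only [Sym2.eq_iff] at this
        rcases this with ⟨h, -⟩ | ⟨-, h⟩
        · exact hzu h
        · exact hxu.ne h
      · have := congrArg Subtype.val e
        simp only [Sym2.eq_iff] at this
        rcases this with ⟨h, -⟩ | ⟨-, h⟩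
        · exact hxv h
        · exact huv.ne h
    choose c hc hn using exists_missing_colour hG col hp
    have hadj : ∀ u v, G.Adj u v → c u ≠ c v := fun u v =>
      missing_colour_ne_of_adj hsymm hc hn hstar
    have hdist : ∀ u v w, G.Adj u v → G.Adj v w → u ≠ w → c u ≠ c w := fun u v w =>
      missing_colour_ne_of_common_neighbour hsymm hp hc hn hstar
    have hc2 : ∀ v w, G.Adj v w → col v w ≠ c v ∧ col v w ≠ c w := fun v w h =>
      ⟨hc v w h, by rw [hsymm]; exact hc w v h.symm⟩
    refine ⟨?_, SimpleGraph.Coloring.mk c (fun {u v} h => hadj u v h),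
      (isDistanceTwoColouring_iff _).2 hdist⟩
    -- `P` marks the sources of the orientation.
    let P : V → Prop := fun u => ∃ v, G.Adj u v ∧ col u v = idempotentLatinSquare (c u) (c v)
    have hP : ∀ u v, G.Adj u v → (P u ↔ col u v = idempotentLatinSquare (c u) (c v)) := by
      intro u v huv
      refine ⟨?_, fun h => ⟨v, huv, h⟩⟩
      rintro ⟨w, huw, h⟩
      exact colour_eq_latinSquare_of_common_endpoint hp hc2 hn hadj hdist huw huv h
    refine ⟨SimpleGraph.Coloring.mk (fun u => if P u then 0 else 1) ?_⟩
    intro u v huv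
    have h1 := hP u v huv
    have h2 := hP v u huv.symm
    have h3 := idempotentLatinSquare_eq_or_eq _ _ _ (hadj u v huv) (hc2 u v huv).1
      (hc2 u v huv).2
    have h4 := idempotentLatinSquare_swap_ne _ _ (hadj u v huv)
    rw [hsymm v u] at h2
    rcases h3 with h3 | h3
    · have hu : P u := h1.2 h3
      have hv : ¬ P v := fun h => h4 (h3.symm.trans (h2.1 h))
      simp [hu, hv]
    · have hv : P v := h2.2 h3
      have hu : ¬ P u := fun h => h4 ((h1.1 h).symm.trans h3)
      simp [hu, hv]
  · rintro ⟨⟨s⟩, c, hc⟩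
    exact lineGraph_starColourable_of_bipartite s c ((isDistanceTwoColouring_iff c).1 hc)
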